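/- Let $G=\mathrm{Sym}(\mathbb N)$ be the group of all permutations of $\mathbb N$. For a set $X$ with a left action of $G$, a set $D\subseteq\mathbb N$ supports $x\in X$ if every $\pi\in G$ that fixes each element of $D$ satisfies $\pi\cdot x=x$. A finite set $D\subseteq\mathbb N$ is the least support of $x$, written $\mathrm{supp}(x)$, if $D$ supports $x$, no proper subset of $D$ supports $x$, and no other finite subset of $\mathbb N$ has these two properties. A nominal set is a set $X$ with an action of $G$ such that every $x\in X$ has a least support; its nominal dimension is $\sup_{x\in X}|\mathrm{supp}(x)|$. It is single-orbit if it consists of exactly one $G$-orbit (so it is nonempty). Two nominal sets are isomorphic if there is a $G$-equivariant bijection between them. Then the number of single-orbit nominal sets of nominal dimension at most $k$, up to isomorphism, is at most $2^{O(k^2)}$. That is, there is a constant $C$ such that for every integer $k\ge 0$ this number is finite and at most $2^{Ck^2}$. -/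

import Mathlib

universe u

/-- A finite set `D` of natural numbers is the least support of `x`, for an action of `Sym(ℕ)`:
it supports `x`, no proper subset of it supports `x`, and it is the only finite set with these
two properties. Here `MulAction.Supports (Equiv.Perm ℕ) D x` says that every permutation of `ℕ`
fixing all elements of `D` fixes `x`. -/
structure IsLeastSupport {X : Type u} [MulAction (Equiv.Perm ℕ) X] (D : Finset ℕ) (x : X) :
    Prop where
  supports : MulAction.Supports (Equiv.Perm ℕ) (D : Set ℕ) x
  minimal : ∀ E : Set ℕ, E ⊂ (D : Set ℕ) → ¬ MulAction.Supports (Equiv.Perm ℕ) E x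
  unique : ∀ E : Finset ℕ, MulAction.Supports (Equiv.Perm ℕ) (E : Set ℕ) x →
    (∀ F : Set ℕ, F ⊂ (E : Set ℕ) → ¬ MulAction.Supports (Equiv.Perm ℕ) F x) → E = D

/-- A nominal set (for the equality symmetry): a set with an action of `Sym(ℕ)` such that every
element has a least support. -/
structure NominalSet : Type (u + 1) where
  carrier : Type u
  [action : MulAction (Equiv.Perm ℕ) carrier]
  exists_leastSupport : ∀ x : carrier, ∃ D : Finset ℕ, IsLeastSupport D x

namespace NominalSet

attribute [instance] NominalSet.action

/-- The least support of an element of a nominal set. -/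
noncomputable def supp (X : NominalSet.{u}) (x : X.carrier) : Finset ℕ :=
  (X.exists_leastSupport x).choose

theorem isLeastSupport_supp (X : NominalSet.{u}) (x : X.carrier) :
    IsLeastSupport (X.supp x) x :=
  (X.exists_leastSupport x).choose_spec

/-- The nominal dimension: the supremum of the sizes of the least supports. -/
noncomputable def nominalDimension (X : NominalSet.{u}) : ℕ∞ :=
  ⨆ x : X.carrier, ((X.supp x).card : ℕ∞)

/-- `X` consists of exactly one orbit (in particular it is nonempty). -/
def IsSingleOrbit (X : NominalSet.{u}) : Prop :=
  ∃ x : X.carrier, MulAction.orbit (Equiv.Perm ℕ) x = Set.univ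

/-- Two nominal sets are isomorphic if there is an equivariant bijection between them. -/
def Isomorphic (X Y : NominalSet.{u}) : Prop :=
  ∃ f : X.carrier ≃ Y.carrier, ∀ (π : Equiv.Perm ℕ) (x : X.carrier), f (π • x) = π • f x

theorem isomorphic_equivalence : Equivalence Isomorphic.{u} where
  refl X := ⟨Equiv.refl _, fun _ _ => rfl⟩
  symm := by
    rintro X Y ⟨f, hf⟩
    refine ⟨f.symm, fun π y => ?_⟩
    rw [Equiv.symm_apply_eq, hf, Equiv.apply_symm_apply]
  trans := by
    rintro X Y Z ⟨f, hf⟩ ⟨g, hg⟩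
    exact ⟨f.trans g, fun π x => by simp [hf, hg]⟩

/-- The single-orbit nominal sets of nominal dimension at most `k`. -/
def SingleOrbit (k : ℕ) : Type (u + 1) :=
  {X : NominalSet.{u} // X.IsSingleOrbit ∧ X.nominalDimension ≤ (k : ℕ∞)}

/-- Isomorphism, as an equivalence relation on the single-orbit nominal sets of nominal dimension
at most `k`. -/
def singleOrbitSetoid (k : ℕ) : Setoid (SingleOrbit.{u} k) where
  r X Y := Isomorphic X.1 Y.1
  iseqv := ⟨fun X => isomorphic_equivalence.refl X.1,
    fun h => isomorphic_equivalence.symm h,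
    fun h₁ h₂ => isomorphic_equivalence.trans h₁ h₂⟩

/-- The isomorphism types of single-orbit nominal sets of nominal dimension at most `k`. -/
def SingleOrbitTypes (k : ℕ) : Type (u + 1) :=
  Quotient (singleOrbitSetoid.{u} k)

end NominalSet

/-! A single-orbit nominal set is `G` modulo the stabilizer of any of its points `x`. Moving `x`
along its orbit makes its least support `{0, …, n - 1}` with `n ≤ k`. The stabilizer then contains
the pointwise fixer of this set and preserves the set, so `n` and its trace on `Sym(k)` determine it
(`IsInitiallySupported.stabilizer_le`). It remains to count subgroups of `Sym(n)`. A subgroup is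
generated by one Sylow subgroup per prime `p ≤ n`. With `m = v_p(n!)`, each `p`-subgroup lies in one
of at most `n!` Sylow subgroups of order `p ^ m`, each having at most `p ^ (m ^ 2)` subgroups. As `m
≤ n / (p - 1)`, the logarithm of the count is at most `π(n) n log n + n² ∑ log p / (p - 1)²`. This
is `O(n²)` by Chebyshev's bound and convergence of the series. -/

/-! ### Subgroups of finite groups via Sylow theory -/

section SubgroupCounting

variable {G : Type*} [Group G] [Finite G]

/-- A subgroup `H` of a finite `p`-group either contains a `j`-generated subgroup of order at least
`p ^ j`, or is itself `j`-generated. -/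
theorem IsPGroup.exists_fin_closure_le {p : ℕ} [Fact p.Prime] (hG : IsPGroup p G)
    (H : Subgroup G) (j : ℕ) :
    ∃ f : Fin j → G, Subgroup.closure (Set.range f) ≤ H ∧
      (p ^ j ≤ Nat.card (Subgroup.closure (Set.range f)) ∨ Subgroup.closure (Set.range f) = H) := by
  have hp : 1 < p := (Fact.out : p.Prime).one_lt
  induction j with
  | zero => exact ⟨Fin.elim0, by simp, Or.inl (by simp)⟩
  | succ j ih =>
    obtain ⟨f, hle, hf⟩ := ih
    set K := Subgroup.closure (Set.range f) with hK
    by_cases hKH : K = H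
    · refine ⟨Fin.cons 1 f, ?_⟩
      have : Subgroup.closure (Set.range (Fin.cons 1 f : Fin (j + 1) → G)) = H := by
        rw [Fin.range_cons, Subgroup.closure_insert_one, ← hK, hKH]
      exact ⟨this.le, Or.inr this⟩
    · have hcard := hf.resolve_right hKH
      obtain ⟨g, hgH, hgK⟩ := SetLike.exists_of_lt (lt_of_le_of_ne hle hKH)
      refine ⟨Fin.cons g f, ?_, Or.inl ?_⟩
      · rw [Fin.range_cons, Subgroup.closure_le, Set.insert_subset_iff]
        exact ⟨hgH, Subgroup.subset_closure.trans hle⟩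
      · set K' := Subgroup.closure (Set.range (Fin.cons g f : Fin (j + 1) → G)) with hK'
        have hKK' : K ≤ K' := Subgroup.closure_mono (by
          rw [Fin.range_cons]; exact Set.subset_insert _ _)
        have hg : g ∈ K' := Subgroup.subset_closure ⟨0, by simp⟩
        have hlt : Nat.card K < Nat.card K' := by
          by_contra! h
          exact hgK (Subgroup.eq_of_le_of_card_ge hKK' h ▸ hg)
        -- Both orders are powers of `p`, so a strict increase gains at least a factor `p`.
        obtain ⟨a, ha⟩ := (IsPGroup.iff_card).1 (hG.to_subgroup K)
        obtain ⟨b, hb⟩ := (IsPGroup.iff_card).1 (hG.to_subgroup K')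
        rw [ha, hb] at hlt
        rw [ha] at hcard
        have h1 := (Nat.pow_le_pow_iff_right hp).1 hcard
        have h2 := (Nat.pow_lt_pow_iff_right hp).1 hlt
        rw [hb]
        exact Nat.pow_le_pow_right (by omega) (by omega)

/-- Every subgroup is generated by `m` elements, so it suffices to count `m`-tuples. -/
theorem Subgroup.card_le_of_card_eq_prime_pow {p m : ℕ} [Fact p.Prime] (h : Nat.card G = p ^ m) :
    Nat.card (Subgroup G) ≤ (p ^ m) ^ m := by
  have hsurj : Function.Surjective fun f : Fin m → G => Subgroup.closure (Set.range f) := by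
    intro H
    obtain ⟨f, hle, hf | hf⟩ := (IsPGroup.of_card h).exists_fin_closure_le H m
    · exact ⟨f, Subgroup.eq_of_le_of_card_ge hle ((Subgroup.card_le_card_group H).trans (h ▸ hf))⟩
    · exact ⟨f, hf⟩
  simpa [Nat.card_fun, h] using Nat.card_le_card_of_surjective _ hsurj

/-- The number of `p`-subgroups of a finite group. -/
theorem card_isPGroup_subgroup_le (p : ℕ) [Fact p.Prime] :
    Nat.card {P : Subgroup G // IsPGroup p P} ≤
      Nat.card G * p ^ ((Nat.card G).factorization p) ^ 2 := by
  classical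
  set m := (Nat.card G).factorization p with hm
  choose Q hQ using fun P : {P : Subgroup G // IsPGroup p P} => P.2.exists_le_sylow
  let φ : {P : Subgroup G // IsPGroup p P} → Σ S : Sylow p G, Subgroup (S : Subgroup G) :=
    fun P => ⟨Q P, P.1.subgroupOf (Q P)⟩
  have hφ : Function.Injective φ := by
    have key (P) : Subgroup.map ((φ P).1 : Subgroup G).subtype (φ P).2 = P.1 :=
      Subgroup.map_subgroupOf_eq_of_le (hQ P)
    intro P P' h
    apply Subtype.ext
    rw [← key P, ← key P', h]
  have := Fintype.ofFinite (Sylow p G)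
  calc Nat.card {P : Subgroup G // IsPGroup p P}
      ≤ Nat.card (Σ S : Sylow p G, Subgroup (S : Subgroup G)) :=
        Nat.card_le_card_of_injective φ hφ
    _ = ∑ S : Sylow p G, Nat.card (Subgroup (S : Subgroup G)) := Nat.card_sigma
    _ ≤ ∑ _S : Sylow p G, p ^ m ^ 2 := by
        refine Finset.sum_le_sum fun S _ => ?_
        rw [pow_two m, pow_mul]
        exact Subgroup.card_le_of_card_eq_prime_pow S.card_eq_multiplicity
    _ = Nat.card (Sylow p G) * p ^ m ^ 2 := by simp
    _ ≤ Nat.card G * p ^ m ^ 2 := by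
        gcongr
        have S : Sylow p G := default
        exact Nat.le_of_dvd Nat.card_pos (S.card_dvd_index.trans (Subgroup.index_dvd_card _))

/-- A finite group is determined by one Sylow subgroup for each prime dividing the order. -/
theorem Subgroup.card_le_prod_isPGroup (s : Finset ℕ) (hs : (Nat.card G).primeFactors ⊆ s) :
    Nat.card (Subgroup G) ≤ ∏ p ∈ s, Nat.card {P : Subgroup G // IsPGroup p P} := by
  classical
  let φ : Subgroup G → (p : s) → {P : Subgroup G // IsPGroup p P} := fun H p =>
    ⟨((default : Sylow p H) : Subgroup H).map H.subtype, (default : Sylow p H).isPGroup'.map _⟩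
  have key (H : Subgroup G) : ⨆ p, (φ H p).1 = H := by
    have hle : ⨆ p, (φ H p).1 ≤ H := iSup_le fun p => Subgroup.map_subtype_le _
    refine Subgroup.eq_of_le_of_card_ge hle (Nat.le_of_dvd Nat.card_pos ?_)
    -- Each prime power dividing `|H|` divides the order of a Sylow subgroup of `H`, hence that of
    -- the join.
    rw [Nat.dvd_iff_prime_pow_dvd_dvd]
    intro p k hp hk
    have : Fact p.Prime := ⟨hp⟩
    rcases Nat.eq_zero_or_pos k with rfl | hk0
    · simp
    have hps : p ∈ s := hs (Nat.mem_primeFactors.2 ⟨hp,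
      (dvd_pow_self p hk0.ne').trans (hk.trans (Subgroup.card_subgroup_dvd_card H)),
      Nat.card_pos.ne'⟩)
    refine dvd_trans ?_ (Subgroup.card_dvd_of_le (le_iSup (fun p => (φ H p).1) ⟨p, hps⟩))
    change p ^ k ∣ Nat.card (Subgroup.map H.subtype (default : Sylow p H))
    rw [Subgroup.card_map_of_injective H.subtype_injective]
    exact (default : Sylow p H).pow_dvd_card_of_pow_dvd_card hk
  have hφ : Function.Injective φ := fun H H' h => by rw [← key H, ← key H', h]
  calc Nat.card (Subgroup G) ≤ Nat.card ((p : s) → {P : Subgroup G // IsPGroup p P}) :=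
        Nat.card_le_card_of_injective φ hφ
    _ = ∏ p : s, Nat.card {P : Subgroup G // IsPGroup p P} := Nat.card_pi
    _ = _ := Finset.prod_coe_sort s fun p => Nat.card {P : Subgroup G // IsPGroup p P}

end SubgroupCounting

/-! ### Prime estimates and subgroups of symmetric groups -/

theorem Nat.primeCounting_mul_log_le (n : ℕ) :
    (Nat.primeCounting n : ℝ) * Real.log n ≤ 6 * n := by
  rcases lt_or_ge n 2 with hn | hn
  · interval_cases n <;> simp
  have hx : (1 : ℝ) < n := by exact_mod_cast hn
  -- Chebyshev's bound with primes split at `√n`; the two terms contribute `4 * n` and `2 * n`.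
  have h := Chebyshev.pi_le_log4_mul_div hx
  rw [Nat.floor_natCast] at h
  have hlog : 0 < Real.log n := Real.log_pos hx
  have hsq : Real.log √(n : ℝ) = Real.log n / 2 := Real.log_sqrt (by positivity)
  have hsle : Real.log n ≤ 2 * √(n : ℝ) := by
    have := Real.log_le_self (Real.sqrt_nonneg (n : ℝ))
    rw [hsq] at this
    linarith
  have h4 : Real.log 4 ≤ 2 := by
    have : Real.log 4 = 2 * Real.log 2 := by
      rw [show (4 : ℝ) = 2 ^ 2 by norm_num, Real.log_pow]; norm_num
    have := Real.log_two_lt_d9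
    linarith
  have hss : √(n : ℝ) * √(n : ℝ) = n := Real.mul_self_sqrt (by positivity)
  calc (Nat.primeCounting n : ℝ) * Real.log n
      ≤ (Real.log 4 * n / Real.log √(n : ℝ) + √(n : ℝ)) * Real.log n := by gcongr
    _ = 2 * (Real.log 4 * n) + √(n : ℝ) * Real.log n := by
        rw [hsq]; field_simp
    _ ≤ 2 * (2 * n) + √(n : ℝ) * (2 * √(n : ℝ)) := by gcongr
    _ = 6 * n := by linear_combination 2 * hss

/-- Comparison with `8 * n ^ (-3/2)`, from `log n ≤ 2 √n` and `n ≤ 2 (n - 1)` for `n ≥ 2`. -/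
theorem summable_log_div_sub_one_sq :
    Summable fun n : ℕ => Real.log n / ((n : ℝ) - 1) ^ 2 := by
  have h : Summable fun n : ℕ => 8 * (n : ℝ) ^ (-(3 / 2) : ℝ) :=
    (Real.summable_nat_rpow.2 (by norm_num)).mul_left 8
  refine Summable.of_nonneg_of_le (fun n => div_nonneg (Real.log_natCast_nonneg n) (sq_nonneg _))
    (fun n => ?_) h
  rcases lt_or_ge n 2 with hn | hn
  · interval_cases n <;> simp
  have hx : (2 : ℝ) ≤ n := by exact_mod_cast hn
  have hlog : Real.log n ≤ 2 * (n : ℝ) ^ (1 / 2 : ℝ) := by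
    have := Real.log_le_rpow_div (x := n) (by positivity) (show (0 : ℝ) < 1 / 2 by norm_num)
    linarith
  have hsplit : (n : ℝ) ^ (1 / 2 : ℝ) = (n : ℝ) ^ (-(3 / 2) : ℝ) * (n : ℝ) ^ 2 := by
    rw [← Real.rpow_natCast, ← Real.rpow_add (by positivity)]
    norm_num
  have hpos : 0 < (n : ℝ) ^ (-(3 / 2) : ℝ) := by positivity
  rw [div_le_iff₀ (pow_pos (by linarith) 2)]
  calc Real.log n ≤ 2 * ((n : ℝ) ^ (-(3 / 2) : ℝ) * (n : ℝ) ^ 2) := hsplit ▸ hlog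
    _ ≤ 8 * (n : ℝ) ^ (-(3 / 2) : ℝ) * ((n : ℝ) - 1) ^ 2 := by
        have : (n : ℝ) ^ 2 ≤ 4 * ((n : ℝ) - 1) ^ 2 := by nlinarith
        nlinarith

theorem log_card_subgroup_perm_le (n : ℕ) :
    Real.log (Nat.card (Subgroup (Equiv.Perm (Fin n)))) ≤
      (6 + ∑' q : ℕ, Real.log q / ((q : ℝ) - 1) ^ 2) * (n : ℝ) ^ 2 := by
  set S := ∑' q : ℕ, Real.log q / ((q : ℝ) - 1) ^ 2
  have hcard : Nat.card (Equiv.Perm (Fin n)) = n.factorial := by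
    rw [Nat.card_eq_fintype_card, Fintype.card_perm, Fintype.card_fin]
  have hprime {p : ℕ} (hp : p ∈ n.primesLE) : p.Prime := (Nat.mem_primesLE.1 hp).2
  have hsub : (Nat.card (Equiv.Perm (Fin n))).primeFactors ⊆ n.primesLE := by
    intro p hp
    rw [hcard] at hp
    have hp' := Nat.prime_of_mem_primeFactors hp
    exact Nat.mem_primesLE.2 ⟨hp'.dvd_factorial.1 (Nat.dvd_of_mem_primeFactors hp), hp'⟩
  have hprod : Nat.card (Subgroup (Equiv.Perm (Fin n))) ≤
      ∏ p ∈ n.primesLE, n.factorial * p ^ (n.factorial.factorization p) ^ 2 := by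
    refine (Subgroup.card_le_prod_isPGroup _ hsub).trans (Finset.prod_le_prod' fun p hp => ?_)
    have : Fact p.Prime := ⟨hprime hp⟩
    simpa only [hcard] using card_isPGroup_subgroup_le (G := Equiv.Perm (Fin n)) p
  have hfac : Real.log n.factorial ≤ n * Real.log n := by
    rw [← Real.log_pow]
    exact Real.log_le_log (by exact_mod_cast n.factorial_pos) (by exact_mod_cast n.factorial_le_pow)
  have hpart {p : ℕ} (hp : p ∈ n.primesLE) :
      Real.log ((p : ℝ) ^ (n.factorial.factorization p) ^ 2) ≤
        (n : ℝ) ^ 2 * (Real.log p / ((p : ℝ) - 1) ^ 2) := by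
    have : Fact p.Prime := ⟨hprime hp⟩
    have h2 : (2 : ℝ) ≤ p := by exact_mod_cast (hprime hp).two_le
    -- Legendre: `(p - 1) v_p(n!)` is `n` minus its base-`p` digit sum.
    have hm : (p - 1) * n.factorial.factorization p ≤ n := by
      rw [Nat.factorization_def _ (hprime hp), sub_one_mul_padicValNat_factorial]
      exact Nat.sub_le _ _
    have hm' : ((p : ℝ) - 1) * n.factorial.factorization p ≤ n := by
      have := (Nat.cast_le (α := ℝ)).2 hm
      rwa [Nat.cast_mul, Nat.cast_sub (hprime hp).one_le, Nat.cast_one] at this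
    rw [Real.log_pow, Nat.cast_pow, mul_div_assoc', le_div_iff₀ (pow_pos (by linarith) 2)]
    calc ((n.factorial.factorization p : ℕ) : ℝ) ^ 2 * Real.log p * ((p : ℝ) - 1) ^ 2
        = (((p : ℝ) - 1) * n.factorial.factorization p) ^ 2 * Real.log p := by ring
      _ ≤ (n : ℝ) ^ 2 * Real.log p := by
          have : 0 ≤ ((p : ℝ) - 1) * n.factorial.factorization p :=
            mul_nonneg (by linarith) (Nat.cast_nonneg _)
          have := Real.log_natCast_nonneg p
          gcongr
  calc Real.log (Nat.card (Subgroup (Equiv.Perm (Fin n))))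
      ≤ Real.log (∏ p ∈ n.primesLE,
          ((n.factorial : ℝ) * (p : ℝ) ^ (n.factorial.factorization p) ^ 2)) :=
        Real.log_le_log (by exact_mod_cast Nat.card_pos) (by exact_mod_cast hprod)
    _ = ∑ p ∈ n.primesLE,
          (Real.log n.factorial + Real.log ((p : ℝ) ^ (n.factorial.factorization p) ^ 2)) := by
        have h0 {p : ℕ} (hp : p ∈ n.primesLE) :
            (p : ℝ) ^ (n.factorial.factorization p) ^ 2 ≠ 0 :=
          pow_ne_zero _ (by exact_mod_cast (hprime hp).ne_zero)
        have h1 : (n.factorial : ℝ) ≠ 0 := by exact_mod_cast n.factorial_ne_zero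
        rw [Real.log_prod fun p hp => mul_ne_zero h1 (h0 hp)]
        exact Finset.sum_congr rfl fun p hp => Real.log_mul h1 (h0 hp)
    _ ≤ ∑ p ∈ n.primesLE,
          (n * Real.log n + (n : ℝ) ^ 2 * (Real.log p / ((p : ℝ) - 1) ^ 2)) :=
        Finset.sum_le_sum fun p hp => add_le_add hfac (hpart hp)
    _ = n * (n.primeCounting * Real.log n) +
          (n : ℝ) ^ 2 * ∑ p ∈ n.primesLE, Real.log p / ((p : ℝ) - 1) ^ 2 := by
        rw [Finset.sum_add_distrib, ← Finset.mul_sum _ _ ((n : ℝ) ^ 2), Finset.sum_const,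
          Nat.primesLE_card_eq_primeCounting, nsmul_eq_mul]
        ring
    _ ≤ n * (6 * n) + (n : ℝ) ^ 2 * S := by
        refine add_le_add (mul_le_mul_of_nonneg_left n.primeCounting_mul_log_le n.cast_nonneg)
          (mul_le_mul_of_nonneg_left ?_ (sq_nonneg _))
        exact summable_log_div_sub_one_sq.sum_le_tsum _ fun q _ =>
          div_nonneg (Real.log_natCast_nonneg q) (sq_nonneg _)
    _ = (6 + S) * (n : ℝ) ^ 2 := by ring

/-- The number of subgroups of the symmetric group of degree `n` is `2 ^ O(n ^ 2)`. -/
theorem exists_card_subgroup_perm_le :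
    ∃ C : ℕ, ∀ n : ℕ, Nat.card (Subgroup (Equiv.Perm (Fin n))) ≤ 2 ^ (C * n ^ 2) := by
  obtain ⟨C, hC⟩ := exists_nat_ge
    ((6 + ∑' q : ℕ, Real.log q / ((q : ℝ) - 1) ^ 2) / Real.log 2)
  refine ⟨C, fun n => ?_⟩
  rw [div_le_iff₀ (Real.log_pos one_lt_two)] at hC
  have hpos : (0 : ℝ) < Nat.card (Subgroup (Equiv.Perm (Fin n))) := by
    exact_mod_cast Nat.card_pos
  have : (Nat.card (Subgroup (Equiv.Perm (Fin n))) : ℝ) ≤ 2 ^ (C * n ^ 2) := by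
    rw [← Real.log_le_log_iff hpos (by positivity), Real.log_pow, Nat.cast_mul, Nat.cast_pow,
      mul_right_comm]
    exact (log_card_subgroup_perm_le n).trans (by gcongr)
  exact_mod_cast this

/-! ### Stabilizers and least supports -/

open MulAction

section LeastSupport

variable {X Y : Type u} [MulAction (Equiv.Perm ℕ) X] [MulAction (Equiv.Perm ℕ) Y]

theorem MulAction.Supports.perm_image {E : Set ℕ} {x : X}
    (h : Supports (Equiv.Perm ℕ) E x) (π : Equiv.Perm ℕ) :
    Supports (Equiv.Perm ℕ) (π '' E) (π • x) := by
  intro σ hσ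
  have : (π⁻¹ * σ * π) • x = x := h _ fun a ha => by
    have h1 : σ (π a) = π a := hσ (Set.mem_image_of_mem π ha)
    simp [h1]
  rwa [mul_smul, mul_smul, inv_smul_eq_iff] at this

/-- The stabilizer of an element leaves its least support invariant. -/
theorem IsLeastSupport.image_eq {D : Finset ℕ} {x : X} (h : IsLeastSupport D x)
    {π : Equiv.Perm ℕ} (hπ : π • x = x) : π '' (D : Set ℕ) = D := by
  have hcoe : ((D.map π.toEmbedding : Finset ℕ) : Set ℕ) = π '' D := by simp
  -- The image of `D` is a minimal support of `π • x = x`, so uniqueness applies.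
  rw [← hcoe, h.unique (D.map π.toEmbedding)]
  · rw [hcoe]
    simpa only [hπ] using h.supports.perm_image π
  · rw [hcoe]
    intro F hF hs
    refine h.minimal (π.symm '' F) ?_ ?_
    · have := π.symm.injective.image_strictMono hF
      rwa [π.symm_image_image] at this
    · have := hs.perm_image π⁻¹
      rwa [inv_smul_eq_iff.2 hπ.symm] at this

/-- `x` is supported by `{0, …, n - 1}`, and its stabilizer leaves that set invariant. -/
structure IsInitiallySupported (n : ℕ) (x : X) : Prop where
  supports : Supports (Equiv.Perm ℕ) (Set.Iio n) x
  image_eq : ∀ π : Equiv.Perm ℕ, π • x = x → π '' Set.Iio n = Set.Iio n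

theorem IsLeastSupport.exists_isInitiallySupported {D : Finset ℕ} {x : X}
    (h : IsLeastSupport D x) : ∃ τ : Equiv.Perm ℕ, IsInitiallySupported D.card (τ • x) := by
  have := Equiv.Perm.isMultiplyPretransitive ℕ D.card
  obtain ⟨τ, hτ⟩ := MulAction.exists_smul_eq (Equiv.Perm ℕ)
    (D.orderEmbOfFin rfl).toEmbedding (Fin.valEmbedding : Fin D.card ↪ ℕ)
  have himage : τ '' (D : Set ℕ) = Set.Iio D.card := by
    rw [← D.range_orderEmbOfFin rfl, ← Set.range_comp, ← Fin.range_val]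
    congr 1
    exact congrArg DFunLike.coe hτ
  refine ⟨τ, himage ▸ h.supports.perm_image τ, fun π hπ => ?_⟩
  have hfix : (τ⁻¹ * π * τ) • x = x := by
    rw [mul_smul, mul_smul, inv_smul_eq_iff, hπ]
  have := congrArg (τ '' ·) (h.image_eq hfix)
  simp only [himage] at this
  calc π '' Set.Iio D.card = τ '' ((τ⁻¹ * π * τ : Equiv.Perm ℕ) '' (D : Set ℕ)) := by
        rw [← himage, Set.image_image, Set.image_image]
        simp
    _ = Set.Iio D.card := this

/-- The permutations of `Fin k`, extended by the identity to `ℕ`, that fix `x`. -/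
def finStabilizer (k : ℕ) (x : X) : Subgroup (Equiv.Perm (Fin k)) :=
  (stabilizer (Equiv.Perm ℕ) x).comap (Equiv.Perm.extendDomainHom Fin.equivSubtype)

/-- Replace `π` by `σ`, equal to `π` below `n` and to the identity elsewhere. Then `π⁻¹ * σ` fixes
`{0, …, n - 1}` pointwise, so `σ` and `π` act alike on both `x` and `y`, while `σ` comes from `Fin
k`. -/
theorem IsInitiallySupported.stabilizer_le {n k : ℕ} (hnk : n ≤ k) {x : X} {y : Y}
    (hx : IsInitiallySupported n x) (hy : IsInitiallySupported n y)
    (h : finStabilizer k x = finStabilizer k y) :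
    stabilizer (Equiv.Perm ℕ) x ≤ stabilizer (Equiv.Perm ℕ) y := by
  intro π hπ
  have hn : ∀ a, a < n ↔ π a < n := fun a => by
    have := hx.image_eq π hπ
    rw [← Set.mem_Iio, ← Set.mem_Iio, ← π.injective.mem_set_image, this]
  let σ : Equiv.Perm ℕ := Equiv.Perm.ofSubtype (π.subtypePerm (p := (· < n)) fun a => (hn a).symm)
  have hσ {a : ℕ} (ha : a < n) : σ a = π a :=
    Equiv.Perm.ofSubtype_apply_of_mem (p := (· < n)) _ ha
  have hσ' {a : ℕ} (ha : ¬ a < n) : σ a = a :=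
    Equiv.Perm.ofSubtype_apply_of_not_mem (p := (· < n)) _ ha
  have hmul {Z : Type u} [MulAction (Equiv.Perm ℕ) Z] {z : Z} (hz : IsInitiallySupported n z) :
      σ • z = π • z := by
    have : (π⁻¹ * σ) • z = z := hz.supports _ fun a ha => by
      simp [hσ ha]
    rwa [mul_smul, inv_smul_eq_iff] at this
  have hk : ∀ a, a < k ↔ σ a < k := fun a => by
    by_cases ha : a < n
    · have := (hn a).1 ha
      rw [hσ ha]
      omega
    · rw [hσ' ha]
  let ρ : Equiv.Perm (Fin k) := Fin.equivSubtype.symm.permCongr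
    (σ.subtypePerm (p := (· < k)) fun a => (hk a).symm)
  have hρ : Equiv.Perm.extendDomainHom Fin.equivSubtype ρ = σ := by
    ext a
    rw [Equiv.Perm.extendDomainHom_apply]
    by_cases ha : a < k
    · rw [Equiv.Perm.extendDomain_apply_subtype (p := (· < k)) _ _ ha]
      simp [ρ]
    · rw [Equiv.Perm.extendDomain_apply_not_subtype (p := (· < k)) _ _ ha, hσ' (by omega)]
  have hmem : ρ ∈ finStabilizer k x := by
    rw [finStabilizer, Subgroup.mem_comap, hρ, mem_stabilizer_iff, hmul hx]
    exact hπ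
  rw [h, finStabilizer, Subgroup.mem_comap, hρ, mem_stabilizer_iff, hmul hy] at hmem
  exact hmem

end LeastSupport

/-! ### Classification and counting of orbits -/

namespace NominalSet

theorem isomorphic_of_stabilizer_eq {X Y : NominalSet.{u}} {x : X.carrier} {y : Y.carrier}
    (hx : orbit (Equiv.Perm ℕ) x = Set.univ) (hy : orbit (Equiv.Perm ℕ) y = Set.univ)
    (h : stabilizer (Equiv.Perm ℕ) x = stabilizer (Equiv.Perm ℕ) y) : Isomorphic X Y := by
  have hxy (π σ : Equiv.Perm ℕ) : π • x = σ • x ↔ π • y = σ • y := by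
    have hx' := mem_stabilizer_iff (g := σ⁻¹ * π) (a := x)
    have hy' := mem_stabilizer_iff (g := σ⁻¹ * π) (a := y)
    rw [mul_smul, inv_smul_eq_iff] at hx' hy'
    rw [← hx', ← hy', h]
  choose g hg using fun z : X.carrier => (hx ▸ Set.mem_univ z : z ∈ orbit (Equiv.Perm ℕ) x)
  choose g' hg' using fun z : Y.carrier => (hy ▸ Set.mem_univ z : z ∈ orbit (Equiv.Perm ℕ) y)
  simp only at hg hg'
  refine ⟨⟨fun z => g z • y, fun w => g' w • x, fun z => ?_, fun w => ?_⟩, fun π z => ?_⟩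
  · exact ((hxy _ _).2 (hg' _)).trans (hg z)
  · exact ((hxy _ _).1 (hg _)).trans (hg' w)
  · change g (π • z) • y = π • g z • y
    rw [smul_smul, ← hxy, hg, mul_smul, hg]

theorem exists_isInitiallySupported {k : ℕ} (X : SingleOrbit.{u} k) :
    ∃ (n : Fin (k + 1)) (x : X.1.carrier), orbit (Equiv.Perm ℕ) x = Set.univ ∧
      IsInitiallySupported (n : ℕ) x := by
  obtain ⟨X, ⟨x, hx⟩, hdim⟩ := X
  obtain ⟨τ, hτ⟩ := (X.isLeastSupport_supp x).exists_isInitiallySupported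
  have hcard : (X.supp x).card ≤ k := by
    exact_mod_cast (le_iSup (fun z : X.carrier => ((X.supp z).card : ℕ∞)) x).trans hdim
  exact ⟨⟨_, Nat.lt_succ_of_le hcard⟩, τ • x, by rw [orbit_smul, hx], hτ⟩

/-- Isomorphism types of single-orbit nominal sets are determined by the size of a support and
a subgroup of a finite symmetric group. -/
theorem exists_injective_singleOrbitTypes (k : ℕ) :
    ∃ φ : SingleOrbitTypes.{u} k → Fin (k + 1) × Subgroup (Equiv.Perm (Fin k)),
      Function.Injective φ := by
  choose n x horb hx using exists_isInitiallySupported.{u} (k := k)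
  -- The size is needed: for `k = 1` the subgroup is always trivial, yet a point and `ℕ` are not
  -- isomorphic.
  refine ⟨fun q => (n q.out, finStabilizer k (x q.out)), fun p q h => ?_⟩
  obtain ⟨hn, hs⟩ := Prod.mk.inj h
  have hp := hx p.out
  have hq := hx q.out
  rw [← hn] at hq
  have hle : ((n p.out : Fin (k + 1)) : ℕ) ≤ k := Fin.is_le _
  refine Quotient.out_equiv_out.1 ?_
  exact isomorphic_of_stabilizer_eq (horb _) (horb _)
    (le_antisymm (hp.stabilizer_le hle hq hs) (hq.stabilizer_le hle hp hs.symm))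

end NominalSet

theorem mainTheorem5 :
    ∃ C : ℕ, ∀ k : ℕ,
      ENat.card (NominalSet.SingleOrbitTypes.{u} k) ≤ (2 : ℕ∞) ^ (C * k ^ 2) := by
  obtain ⟨C, hC⟩ := exists_card_subgroup_perm_le
  refine ⟨C + 1, fun k => ?_⟩
  obtain ⟨φ, hφ⟩ := NominalSet.exists_injective_singleOrbitTypes.{u} k
  -- Finiteness is part of the claim, since `ENat.card` of an infinite type is `⊤`.
  have : Finite (NominalSet.SingleOrbitTypes.{u} k) := Finite.of_injective φ hφ
  have hcard : Nat.card (NominalSet.SingleOrbitTypes.{u} k) ≤ 2 ^ ((C + 1) * k ^ 2) :=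
    calc Nat.card (NominalSet.SingleOrbitTypes.{u} k)
        ≤ Nat.card (Fin (k + 1) × Subgroup (Equiv.Perm (Fin k))) :=
          Nat.card_le_card_of_injective φ hφ
      _ = (k + 1) * Nat.card (Subgroup (Equiv.Perm (Fin k))) := by
          rw [Nat.card_prod, Nat.card_fin]
      _ ≤ 2 ^ k ^ 2 * 2 ^ (C * k ^ 2) := by
          gcongr
          -- `k + 1 ≤ 2 ^ k ≤ 2 ^ k ^ 2`, also at `k = 0`; this is the extra `1` in `C + 1`.
          · exact Nat.lt_two_pow_self.trans_le
              (Nat.pow_le_pow_right two_pos (Nat.le_self_pow two_ne_zero k))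
          · exact hC k
      _ = 2 ^ ((C + 1) * k ^ 2) := by ring
  rw [ENat.card_eq_coe_natCard]
  exact_mod_cast hcard
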